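/- Let $M$ be a closed surface, that is, a compact Hausdorff smooth ($C^\infty$) manifold of dimension two without boundary, and let $\omega$ be an area form on $M$, that is, a smooth nowhere vanishing differential $2$-form. For $F,G\in C^\infty(M)$ let the Poisson bracket $\{F,G\}\colon M\to\mathbb R$ be the function defined by $\{F,G\}\,\omega = dF\wedge dG$. Two continuous functions $F,G\colon M\to\mathbb R$ are said to Poisson commute (in the sense of Cardin and Viterbo) if there are $F_k,G_k\in C^\infty(M)$, $k\in\mathbb N$, such that $F_k\to F$, $G_k\to G$ and $\{F_k,G_k\}\to 0$ as $k\to\infty$, all in the uniform norm. Then two continuous functions $F,G\colon M\to\mathbb R$ Poisson commute if and only if there are $F_k,G_k\in C^\infty(M)$, $k\in\mathbb N$, such that $F_k\to F$ and $G_k\to G$ as $k\to\infty$ in the uniform norm, and $\{F_k,G_k\}\equiv 0$ for all $k$. -/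

import Mathlib

open Bundle Filter
open scoped Manifold ContDiff Topology

noncomputable section

/-- The wedge product `α ∧ β` of two linear forms, `(α ∧ β) (v, w) = α v * β w - α w * β v`. -/
def wedgeForm {V : Type*} [AddCommGroup V] [Module ℝ V] [TopologicalSpace V]
    (α β : V →L[ℝ] ℝ) : V [⋀^Fin 2]→L[ℝ] ℝ where
  toFun v := α (v 0) * β (v 1) - α (v 1) * β (v 0)
  map_update_add' := by
    intro _ v i x y
    fin_cases i <;> simp [Function.update] <;> ring
  map_update_smul' := by
    intro _ v i c x
    fin_cases i <;> simp [Function.update] <;> ring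
  map_eq_zero_of_eq' := by
    intro v i j h hij
    fin_cases i <;> fin_cases j <;> simp_all
  cont := by fun_prop

/-- An area form on a smooth surface `M`: a smooth differential `2`-form which vanishes nowhere. -/
structure AreaForm (M : Type*) [TopologicalSpace M] [ChartedSpace (EuclideanSpace ℝ (Fin 2)) M]
    [IsManifold (𝓡 2) ∞ M] where
  /-- the alternating bilinear form on each tangent space -/
  form : ∀ x : M, TangentSpace (𝓡 2) x [⋀^Fin 2]→L[ℝ] Bundle.Trivial M ℝ x
  /-- smoothness, as a section of the bundle of alternating bilinear forms -/
  contMDiff_form :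
    ContMDiff (𝓡 2) ((𝓡 2).prod 𝓘(ℝ, EuclideanSpace ℝ (Fin 2) [⋀^Fin 2]→L[ℝ] ℝ)) ∞
      fun x : M => TotalSpace.mk' (EuclideanSpace ℝ (Fin 2) [⋀^Fin 2]→L[ℝ] ℝ)
        (E := fun x : M => TangentSpace (𝓡 2) x [⋀^Fin 2]→L[ℝ] Bundle.Trivial M ℝ x) x (form x)
  form_ne_zero : ∀ x : M, form x ≠ 0

/-- The basis of the tangent space at `x` given by the preferred chart at `x`. -/
def stdFrame {M : Type*} [TopologicalSpace M] [ChartedSpace (EuclideanSpace ℝ (Fin 2)) M] (x : M) :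
    Module.Basis (Fin 2) ℝ (TangentSpace (𝓡 2) x) :=
  (EuclideanSpace.basisFun (Fin 2) ℝ).toBasis

/-- The Poisson bracket `{F, G}` of two functions on a surface with an area form `σ`. It is the
function determined by `{F, G} σ = dF ∧ dG`, see `poissonBracket_smul_form` and
`eq_poissonBracket`; it is computed here on a frame, on which its value does not depend. -/
def poissonBracket {M : Type*} [TopologicalSpace M] [ChartedSpace (EuclideanSpace ℝ (Fin 2)) M]
    [IsManifold (𝓡 2) ∞ M] (σ : AreaForm M) (F G : M → ℝ) (x : M) : ℝ :=
  wedgeForm (mvfderiv (𝓡 2) F x) (mvfderiv (𝓡 2) G x) (stdFrame x) / σ.form x (stdFrame x)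

/-- Two `2`-forms on a tangent plane which agree on a frame are equal. -/
theorem form_ext_stdFrame {M : Type*} [TopologicalSpace M]
    [ChartedSpace (EuclideanSpace ℝ (Fin 2)) M] {x : M}
    {η θ : TangentSpace (𝓡 2) x [⋀^Fin 2]→L[ℝ] ℝ}
    (h : η (stdFrame x) = θ (stdFrame x)) : η = θ := by
  apply ContinuousAlternatingMap.toAlternatingMap_injective
  rw [η.toAlternatingMap.eq_smul_basis_det (stdFrame x),
    θ.toAlternatingMap.eq_smul_basis_det (stdFrame x)]
  simp [h]

/-- An area form does not vanish on a frame. -/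
theorem form_stdFrame_ne_zero {M : Type*} [TopologicalSpace M]
    [ChartedSpace (EuclideanSpace ℝ (Fin 2)) M] [IsManifold (𝓡 2) ∞ M] (σ : AreaForm M) (x : M) :
    σ.form x (stdFrame x) ≠ 0 :=
  fun h => σ.form_ne_zero x (form_ext_stdFrame (θ := 0) h)

/-- The defining relation `{F, G} σ = dF ∧ dG` of the Poisson bracket. -/
theorem poissonBracket_smul_form {M : Type*} [TopologicalSpace M]
    [ChartedSpace (EuclideanSpace ℝ (Fin 2)) M] [IsManifold (𝓡 2) ∞ M] (σ : AreaForm M)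
    (F G : M → ℝ) (x : M) (v : Fin 2 → TangentSpace (𝓡 2) x) :
    poissonBracket σ F G x * σ.form x v =
      wedgeForm (mvfderiv (𝓡 2) F x) (mvfderiv (𝓡 2) G x) v := by
  have h : (poissonBracket σ F G x • (σ.form x : TangentSpace (𝓡 2) x [⋀^Fin 2]→L[ℝ] ℝ)) =
      wedgeForm (mvfderiv (𝓡 2) F x) (mvfderiv (𝓡 2) G x) :=
    form_ext_stdFrame (div_mul_cancel₀ _ (form_stdFrame_ne_zero σ x))
  exact congrArg (fun η : TangentSpace (𝓡 2) x [⋀^Fin 2]→L[ℝ] ℝ => η v) h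

/-- The relation `{F, G} σ = dF ∧ dG` determines the Poisson bracket. -/
theorem eq_poissonBracket {M : Type*} [TopologicalSpace M]
    [ChartedSpace (EuclideanSpace ℝ (Fin 2)) M] [IsManifold (𝓡 2) ∞ M] (σ : AreaForm M)
    (F G : M → ℝ) (x : M) (c : ℝ)
    (h : ∀ v : Fin 2 → TangentSpace (𝓡 2) x,
      c * σ.form x v = wedgeForm (mvfderiv (𝓡 2) F x) (mvfderiv (𝓡 2) G x) v) :
    c = poissonBracket σ F G x :=
  mul_right_cancel₀ (form_stdFrame_ne_zero σ x)
    ((h (stdFrame x)).trans (poissonBracket_smul_form σ F G x (stdFrame x)).symm)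

/-- Two continuous functions on a surface with an area form Poisson commute if they are uniform
limits of smooth functions whose Poisson brackets tend to zero uniformly. -/
def PoissonCommute {M : Type*} [TopologicalSpace M] [ChartedSpace (EuclideanSpace ℝ (Fin 2)) M]
    [IsManifold (𝓡 2) ∞ M] (σ : AreaForm M) (F G : C(M, ℝ)) : Prop :=
  ∃ Fs Gs : ℕ → C^∞⟮𝓡 2, M; ℝ⟯,
    TendstoUniformly (fun k x => Fs k x) F atTop ∧
    TendstoUniformly (fun k x => Gs k x) G atTop ∧
    TendstoUniformly (fun k x => poissonBracket σ (Fs k) (Gs k) x) (fun _ => 0) atTop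

end

open MeasureTheory Set
open scoped Pointwise

/-! The bracket is the Jacobian of (F, G) : M → ℝ² relative to the area form, so by compactness a
bracket bounded by ε forces the image to have area at most C ε, with C independent of F and G
(`exists_volume_range_le`). Once this is below s², averaging over translates shows that the image
misses some translate of s ℤ² (`exists_translate_lattice_disjoint`).

Off the lattice, the plane can be pushed smoothly towards the dual grid, moving each coordinate by
at most s / 2, so that near every point one of the two coordinates becomes constant. Composing (F,
G) with this map of rank at most one makes the bracket vanish identically
(`exists_commuting_of_avoids_lattice`). Letting s → 0 gives the nontrivial implication. -/

/-! ### Area of the image of (F, G) -/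

/-- In the chart at a point, the coefficient of an area form is locally bounded. -/
theorem AreaForm.eventually_abs_le {M : Type*} [TopologicalSpace M]
    [ChartedSpace (EuclideanSpace ℝ (Fin 2)) M] [IsManifold (𝓡 2) ∞ M] (σ : AreaForm M)
    (x₀ : M) (b : Fin 2 → EuclideanSpace ℝ (Fin 2)) :
    ∃ C : ℝ, ∀ᶠ x in 𝓝 x₀,
      |σ.form x (fun i => (trivializationAt (EuclideanSpace ℝ (Fin 2)) (TangentSpace (𝓡 2)) x₀).symmL
        ℝ x (b i))| ≤ C := by
  have h := (contMDiffAt_section (IB := 𝓡 2) x₀).1 (σ.contMDiff_form x₀)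
  have h1 := h.continuousAt
  have h2 : ContinuousAt (fun x => |σ.form x (fun i => (trivializationAt (EuclideanSpace ℝ (Fin 2))
      (TangentSpace (𝓡 2)) x₀).symmL ℝ x (b i))|) x₀ := by
    have h3 := (((ContinuousAlternatingMap.apply ℝ (EuclideanSpace ℝ (Fin 2)) ℝ b).continuous.continuousAt).comp h1).abs
    refine h3.congr (Eventually.of_forall fun x => ?_)
    have h4 : (trivializationAt ℝ (Bundle.Trivial M ℝ) x₀).continuousLinearMapAt ℝ x =
        ContinuousLinearMap.id ℝ ℝ := Bundle.Trivial.continuousLinearMapAt_trivialization ℝ M ℝ x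
    simp only [Function.comp_apply, FiberBundle.trivializationAt_continuousAlternatingMap_apply,
      ContinuousAlternatingMap.inCoordinates, h4]
    rfl
  exact ⟨_, (h2.eventually (ge_mem_nhds (lt_add_one _)))⟩

theorem wedgeForm_apply {V : Type*} [AddCommGroup V] [Module ℝ V] [TopologicalSpace V]
    (α β : V →L[ℝ] ℝ) (v : Fin 2 → V) :
    wedgeForm α β v = α (v 0) * β (v 1) - α (v 1) * β (v 0) :=
  rfl

/-- Identifies the Jacobian of (F, G) in a chart with dF ∧ dG on the coordinate frame, hence with
the bracket times the coefficient of the area form. -/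
theorem det_eq_wedgeForm (A : EuclideanSpace ℝ (Fin 2) →L[ℝ] EuclideanSpace ℝ (Fin 2)) :
    A.det = wedgeForm ((EuclideanSpace.proj 0).comp A) ((EuclideanSpace.proj 1).comp A)
      (EuclideanSpace.basisFun (Fin 2) ℝ) := by
  rw [ContinuousLinearMap.det, ← LinearMap.det_toMatrix (EuclideanSpace.basisFun (Fin 2) ℝ).toBasis,
    Matrix.det_fin_two]
  simp [LinearMap.toMatrix_apply, wedgeForm_apply]

/-- The area of the image of `(F, G)` is locally controlled by the Poisson bracket. -/
theorem exists_nhds_volume_image_le {M : Type*} [TopologicalSpace M]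
    [ChartedSpace (EuclideanSpace ℝ (Fin 2)) M] [IsManifold (𝓡 2) ∞ M] (σ : AreaForm M) (x₀ : M) :
    ∃ U ∈ 𝓝 x₀, ∃ C : ENNReal, C ≠ ⊤ ∧ ∀ (F G : C^∞⟮𝓡 2, M; ℝ⟯) (ε : ℝ),
      (∀ x, |poissonBracket σ F G x| ≤ ε) →
      volume ((fun x => !₂[F x, G x]) '' U) ≤ C * ENNReal.ofReal ε := by
  obtain ⟨C, hC⟩ := σ.eventually_abs_le x₀ (EuclideanSpace.basisFun (Fin 2) ℝ)
  set e := extChartAt (𝓡 2) x₀ with he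
  have h1 : ∀ᶠ y in 𝓝 (e x₀), y ∈ e.target ∧ 
      |σ.form (e.symm y) (fun i => (trivializationAt (EuclideanSpace ℝ (Fin 2)) (TangentSpace (𝓡 2)) x₀).symmL
        ℝ (e.symm y) (EuclideanSpace.basisFun (Fin 2) ℝ i))| ≤ C := by
    refine Filter.Eventually.and (extChartAt_target_mem_nhds (I := 𝓡 2) x₀) ?_
    have := continuousAt_extChartAt_symm (I := 𝓡 2) x₀
    rw [ContinuousAt, extChartAt_to_inv] at this
    exact this.eventually hC
  obtain ⟨r, hr, hV⟩ := Metric.eventually_nhds_iff_ball.1 h1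
  refine ⟨e ⁻¹' Metric.ball (e x₀) r ∩ e.source, ?_, ENNReal.ofReal C * volume (Metric.ball (e x₀) r),
    ENNReal.mul_ne_top ENNReal.ofReal_ne_top measure_ball_lt_top.ne, fun F G ε hε => ?_⟩
  · exact inter_mem ((continuousAt_extChartAt x₀) (Metric.ball_mem_nhds _ hr))
      (extChartAt_source_mem_nhds x₀)
  set f : EuclideanSpace ℝ (Fin 2) → EuclideanSpace ℝ (Fin 2) :=
    fun y => !₂[F (e.symm y), G (e.symm y)]
  have key : ∀ y ∈ Metric.ball (e x₀) r, ∃ A : EuclideanSpace ℝ (Fin 2) →L[ℝ] EuclideanSpace ℝ (Fin 2),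
      HasFDerivAt f A y ∧ |A.det| ≤ C * ε := by
    intro y hy
    obtain ⟨hyt, hyC⟩ := hV y hy
    set x := e.symm y with hx
    have hxs : x ∈ (chartAt (EuclideanSpace ℝ (Fin 2)) x₀).source := by
      have := e.map_target hyt
      rwa [he, extChartAt_source] at this
    have hexy : e x = y := e.right_inv hyt
    -- The inverse trivialization of the tangent bundle is the derivative of the inverse chart; this
    -- ties the coefficient bounded in `hyC` to the Jacobian.
    have hT : HasMFDerivAt 𝓘(ℝ, EuclideanSpace ℝ (Fin 2)) (𝓡 2) e.symm y
        ((trivializationAt (EuclideanSpace ℝ (Fin 2)) (TangentSpace (𝓡 2)) x₀).symmL ℝ x) := by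
      rw [TangentBundle.symmL_trivializationAt hxs, ← he, hexy]
      have := mdifferentiableWithinAt_extChartAt_symm (I := 𝓡 2) hyt
      have h3 := this.hasMFDerivWithinAt
      rw [ModelWithCorners.range_eq_univ] at h3 ⊢
      exact h3.hasMFDerivAt Filter.univ_mem
    set T := (trivializationAt (EuclideanSpace ℝ (Fin 2)) (TangentSpace (𝓡 2)) x₀).symmL ℝ x
    have hd : ∀ H : C^∞⟮𝓡 2, M; ℝ⟯, HasFDerivAt (fun y => H (e.symm y))
        ((mvfderiv (𝓡 2) H x).comp T) y := by
      intro H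
      have h4 := (H.contMDiff.mdifferentiable (by simp) x).hasMFDerivAt
      have h5 := HasMFDerivAt.comp y h4 hT
      exact h5.hasFDerivAt
    have hf := ((PiLp.continuousLinearEquiv 2 ℝ (fun _ : Fin 2 => ℝ)).symm.hasFDerivAt).comp y
      (hasFDerivAt_pi (𝕜 := ℝ) (φ := ![fun y => F (e.symm y), fun y => G (e.symm y)])
        (φ' := ![(mvfderiv (𝓡 2) F x).comp T, (mvfderiv (𝓡 2) G x).comp T]) |>.2 (by
          intro i; fin_cases i
          · exact hd F
          · exact hd G))
    have hf' : HasFDerivAt f _ y := hf.congr_of_eventuallyEq (Eventually.of_forall fun z => by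
      ext i; fin_cases i <;> rfl)
    refine ⟨_, hf', ?_⟩
    rw [det_eq_wedgeForm]
    have h6 := poissonBracket_smul_form σ F G x (fun i => T (EuclideanSpace.basisFun (Fin 2) ℝ i))
    have h7 := abs_mul (poissonBracket σ F G x) (σ.form x (fun i => T (EuclideanSpace.basisFun (Fin 2) ℝ i)))
    rw [h6] at h7
    calc _ = _ := h7
      _ ≤ C * ε := by
        rw [mul_comm]
        exact mul_le_mul hyC (hε x) (abs_nonneg _) ((abs_nonneg _).trans hyC)
  choose! A hA hAd using key
  have hsub : (fun x => !₂[F x, G x]) '' (e ⁻¹' Metric.ball (e x₀) r ∩ e.source) ⊆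
      f '' Metric.ball (e x₀) r := by
    rintro _ ⟨x, ⟨hx, hxs⟩, rfl⟩
    exact ⟨e x, hx, by simp only [f, e.left_inv hxs]⟩
  calc _ ≤ volume (f '' Metric.ball (e x₀) r) := measure_mono hsub
    _ ≤ ∫⁻ y in Metric.ball (e x₀) r, ENNReal.ofReal |(A y).det| :=
      addHaar_image_le_lintegral_abs_det_fderiv volume measurableSet_ball
        fun y hy => (hA y hy).hasFDerivWithinAt
    _ ≤ ∫⁻ y in Metric.ball (e x₀) r, ENNReal.ofReal (C * ε) :=
      setLIntegral_mono measurable_const fun y hy => ENNReal.ofReal_le_ofReal (hAd y hy)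
    _ = ENNReal.ofReal C * volume (Metric.ball (e x₀) r) * ENNReal.ofReal ε := by
      have hC0 : 0 ≤ C := (abs_nonneg _).trans (hV (e x₀) (Metric.mem_ball_self hr)).2
      rw [setLIntegral_const, ENNReal.ofReal_mul hC0]
      ring

/-- The area of the image of `(F, G)` is controlled by the Poisson bracket. -/
theorem exists_volume_range_le {M : Type*} [TopologicalSpace M]
    [ChartedSpace (EuclideanSpace ℝ (Fin 2)) M] [IsManifold (𝓡 2) ∞ M] [CompactSpace M]
    (σ : AreaForm M) :
    ∃ C : ENNReal, C ≠ ⊤ ∧ ∀ (F G : C^∞⟮𝓡 2, M; ℝ⟯) (ε : ℝ),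
      (∀ x, |poissonBracket σ F G x| ≤ ε) →
      volume (range fun x => !₂[F x, G x]) ≤ C * ENNReal.ofReal ε := by
  choose U hU C hC h using exists_nhds_volume_image_le σ
  obtain ⟨t, ht⟩ := CompactSpace.elim_nhds_subcover U hU
  refine ⟨∑ x ∈ t, C x, ENNReal.sum_ne_top.2 fun x _ => hC x, fun F G ε hε => ?_⟩
  calc _ ≤ volume (⋃ x ∈ t, (fun x => !₂[F x, G x]) '' U x) := by
        rw [← image_univ, ← top_eq_univ, ← ht, image_iUnion₂]
    _ ≤ ∑ x ∈ t, volume ((fun x => !₂[F x, G x]) '' U x) := measure_biUnion_finset_le _ _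
    _ ≤ ∑ x ∈ t, C x * ENNReal.ofReal ε := Finset.sum_le_sum fun x _ => h x F G ε hε
    _ = _ := by rw [Finset.sum_mul]

/-! ### Missing a translated lattice -/

/-- A set of area less than `s ^ 2` is missed by some translate of the lattice `s ℤ²`. -/
theorem exists_translate_lattice_disjoint {S : Set (EuclideanSpace ℝ (Fin 2))} {s : ℝ} (hs : 0 < s)
    (hS : volume S < ENNReal.ofReal (s ^ 2)) :
    ∃ t : EuclideanSpace ℝ (Fin 2), ∀ p ∈ S, ∀ m n : ℤ,
      ¬ ((p 0 - t 0) / s = m ∧ (p 1 - t 1) / s = n) := by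
  by_contra! hcon
  set b := (EuclideanSpace.basisFun (Fin 2) ℝ)
  set D := ZSpan.fundamentalDomain b.toBasis
  have hfund := ZSpan.isAddFundamentalDomain' b.toBasis (volume : Measure (EuclideanSpace ℝ (Fin 2)))
  have hD : volume D = 1 := by
    rw [measure_congr (ZSpan.fundamentalDomain_ae_parallelepiped b.toBasis volume)]
    simpa using b.volume_parallelepiped
  have h1 : volume (s⁻¹ • S) < 1 := by
    rw [Measure.addHaar_smul]
    simp only [finrank_euclideanSpace, Fintype.card_fin]
    rw [abs_of_pos (by positivity), inv_pow, ENNReal.ofReal_inv_of_pos (by positivity), mul_comm,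
      ← div_eq_mul_inv]
    rw [ENNReal.div_lt_iff]
    · simpa using hS
    · left; simpa using by positivity
    · left; simp
  have : Countable (Submodule.span ℤ (range b.toBasis)).toAddSubgroup :=
    inferInstanceAs (Countable (Submodule.span ℤ (range b.toBasis)))
  -- If the lattice translated by s q meets S for every q, then the ℤ²-translates of s⁻¹ S cover the
  -- unit cell. Their traces on the cell have total area `volume (s⁻¹ • S)`, which is less than 1.
  have h2 : D ⊆ ⋃ g : (Submodule.span ℤ (range b.toBasis)).toAddSubgroup, ((g +ᵥ (s⁻¹ • S)) ∩ D) := by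
    intro q hq
    obtain ⟨p, hp, m, n, hm, hn⟩ := hcon (s • q)
    refine mem_iUnion.2 ⟨⟨q - s⁻¹ • p, ?_⟩, ?_, hq⟩
    · rw [Submodule.mem_toAddSubgroup, Module.Basis.mem_span_iff_repr_mem]
      intro i
      fin_cases i
      · refine ⟨-m, ?_⟩
        simp [b] at hm ⊢
        rw [← hm]; field_simp; ring
      · refine ⟨-n, ?_⟩
        simp [b] at hn ⊢
        rw [← hn]; field_simp; ring
    · refine ⟨s⁻¹ • p, smul_mem_smul_set hp, ?_⟩
      exact sub_add_cancel q (s⁻¹ • p)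
  have h3 := (measure_mono h2).trans (measure_iUnion_le (μ := volume) _)
  rw [← hfund.measure_eq_tsum, hD] at h3
  exact absurd h3 (not_le.2 h1)

/-! ### The rank one map off the lattice -/

/-- The function `sin² (π y) / (sin² (π x) + sin² (π y))`, smooth away from the lattice `ℤ²`. -/
noncomputable def latticeRatio (x y : ℝ) : ℝ :=
  Real.sin (Real.pi * y) ^ 2 / (Real.sin (Real.pi * x) ^ 2 + Real.sin (Real.pi * y) ^ 2)

/-- The second coordinate of a map of rank at most one from `ℝ² \ ℤ²` onto a neighbourhood of the
dual grid. -/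
noncomputable def gridRetract (x y : ℝ) : ℝ :=
  y + Real.smoothTransition (6 * latticeRatio x y - 1) * (⌊y⌋ + 1 / 2 - y)

theorem abs_gridRetract_sub_le (x y : ℝ) : |gridRetract x y - y| ≤ 1 / 2 := by
  have h1 := Real.smoothTransition.nonneg (6 * latticeRatio x y - 1)
  have h2 := Real.smoothTransition.le_one (6 * latticeRatio x y - 1)
  have h3 : |⌊y⌋ + 1 / 2 - y| ≤ 1 / 2 := by
    rw [abs_le]; constructor <;> linarith [Int.floor_le y, Int.lt_floor_add_one y]
  rw [gridRetract, add_sub_cancel_left, abs_mul, abs_of_nonneg h1]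
  nlinarith [abs_nonneg (⌊y⌋ + 1 / 2 - y)]

theorem sin_pi_mul_eq_zero_iff {x : ℝ} : Real.sin (Real.pi * x) = 0 ↔ ∃ n : ℤ, x = n := by
  rw [Real.sin_eq_zero_iff]
  refine exists_congr fun n => ?_
  rw [mul_comm, mul_right_inj' Real.pi_ne_zero, eq_comm]

theorem latticeRatio_denom_pos {x y : ℝ} (h : ∀ m n : ℤ, ¬ (x = m ∧ y = n)) :
    0 < Real.sin (Real.pi * x) ^ 2 + Real.sin (Real.pi * y) ^ 2 := by
  by_cases hx : Real.sin (Real.pi * x) = 0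
  · have hy : Real.sin (Real.pi * y) ≠ 0 := fun hy => by
      obtain ⟨m, hm⟩ := sin_pi_mul_eq_zero_iff.1 hx
      obtain ⟨n, hn⟩ := sin_pi_mul_eq_zero_iff.1 hy
      exact h m n ⟨hm, hn⟩
    positivity
  · positivity

theorem contDiffAt_latticeRatio {x y : ℝ} (h : ∀ m n : ℤ, ¬ (x = m ∧ y = n)) :
    ContDiffAt ℝ ∞ (fun p : ℝ × ℝ => latticeRatio p.1 p.2) (x, y) := by
  unfold latticeRatio
  refine ContDiffAt.div ?_ ?_ (latticeRatio_denom_pos h).ne'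
  · exact (Real.contDiff_sin.comp (contDiff_const.mul contDiff_snd)).contDiffAt.pow 2
  · exact ((Real.contDiff_sin.comp (contDiff_const.mul contDiff_fst)).contDiffAt.pow 2).add
      ((Real.contDiff_sin.comp (contDiff_const.mul contDiff_snd)).contDiffAt.pow 2)

theorem latticeRatio_of_int {x : ℝ} (n : ℤ) : latticeRatio x n = 0 := by
  simp [latticeRatio, sin_pi_mul_eq_zero_iff.2 ⟨n, rfl⟩]

/-- Hence one of the two ratios always exceeds 1/3, the level from which the cutoff in `gridRetract`
equals 1. -/
theorem latticeRatio_add_swap {x y : ℝ} (h : ∀ m n : ℤ, ¬ (x = m ∧ y = n)) :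
    latticeRatio x y + latticeRatio y x = 1 := by
  have := (latticeRatio_denom_pos h).ne'
  rw [latticeRatio, latticeRatio, add_comm (Real.sin (Real.pi * y) ^ 2) (Real.sin (Real.pi * x) ^ 2),
    ← add_div, add_comm, div_self this]

theorem eventually_floor_eq {y : ℝ} (h : ∀ n : ℤ, y ≠ n) : ∀ᶠ z in 𝓝 y, ⌊z⌋ = ⌊y⌋ := by
  filter_upwards [Ioo_mem_nhds ((Int.floor_le y).lt_of_ne (h _).symm) (Int.lt_floor_add_one y)]
    with z hz
  exact Int.floor_eq_iff.2 ⟨hz.1.le, hz.2⟩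

theorem gridRetract_eventually_const {x y : ℝ} (h : ∀ m n : ℤ, ¬ (x = m ∧ y = n))
    (hr : 1 / 3 < latticeRatio x y) :
    ∀ᶠ p in 𝓝 (x, y), gridRetract p.1 p.2 = ⌊y⌋ + 1 / 2 := by
  have hy : ∀ n : ℤ, y ≠ n := by
    rintro n rfl
    rw [latticeRatio_of_int] at hr
    norm_num at hr
  filter_upwards [(contDiffAt_latticeRatio h).continuousAt.eventually (lt_mem_nhds hr),
    (continuousAt_snd (p := (x, y))).eventually (eventually_floor_eq hy)] with p hp hf
  rw [gridRetract, Real.smoothTransition.one_of_one_le (by linarith), hf]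
  ring

/-- The floor jumps only at integral y; there, off the lattice, the ratio is 0, so the cutoff
vanishes nearby and hides the jump. -/
theorem contDiffAt_gridRetract {x y : ℝ} (h : ∀ m n : ℤ, ¬ (x = m ∧ y = n)) :
    ContDiffAt ℝ ∞ (fun p : ℝ × ℝ => gridRetract p.1 p.2) (x, y) := by
  by_cases hy : ∃ n : ℤ, y = n
  · obtain ⟨n, rfl⟩ := hy
    refine contDiffAt_snd.congr_of_eventuallyEq ?_
    filter_upwards [(contDiffAt_latticeRatio h).continuousAt.eventually
      (gt_mem_nhds (show latticeRatio x n < 1 / 6 by simp [latticeRatio_of_int]))] with p hp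
    rw [gridRetract, Real.smoothTransition.zero_of_nonpos (by linarith), zero_mul, add_zero]
  · push Not at hy
    have h1 : ContDiffAt ℝ ∞ (fun p : ℝ × ℝ => p.2 +
        Real.smoothTransition (6 * latticeRatio p.1 p.2 - 1) * (⌊y⌋ + 1 / 2 - p.2)) (x, y) :=
      contDiffAt_snd.add ((Real.smoothTransition.contDiffAt.comp _
        ((contDiffAt_const.mul (contDiffAt_latticeRatio h)).sub contDiffAt_const)).mul
        (contDiffAt_const.sub contDiffAt_snd))
    refine h1.congr_of_eventuallyEq ?_
    filter_upwards [(continuousAt_snd (p := (x, y))).eventually (eventually_floor_eq hy)] with p hp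
    rw [gridRetract, hp]

theorem mvfderiv_eq_zero_of_eventually_const {M : Type*} [TopologicalSpace M]
    [ChartedSpace (EuclideanSpace ℝ (Fin 2)) M] {F : M → ℝ} {x : M} {c : ℝ}
    (h : ∀ᶠ z in 𝓝 x, F z = c) : mvfderiv (𝓡 2) F x = 0 := by
  have : F =ᶠ[𝓝 x] fun _ => c := h
  ext v
  rw [mvfderiv, this.mfderiv_eq]
  rw [mfderiv_const]
  rfl

/-! ### Commuting approximations -/

/-- Two smooth functions which do not take simultaneously values in `a + s ℤ` and `b + s ℤ` are
at distance at most `s / 2` from a Poisson commuting pair. -/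
theorem exists_commuting_of_avoids_lattice {M : Type*} [TopologicalSpace M]
    [ChartedSpace (EuclideanSpace ℝ (Fin 2)) M] [IsManifold (𝓡 2) ∞ M] (σ : AreaForm M)
    (F G : C^∞⟮𝓡 2, M; ℝ⟯) {s : ℝ} (hs : 0 < s) (a b : ℝ)
    (h : ∀ x, ∀ m n : ℤ, ¬ ((F x - a) / s = m ∧ (G x - b) / s = n)) :
    ∃ F' G' : C^∞⟮𝓡 2, M; ℝ⟯, (∀ x, |F' x - F x| ≤ s / 2) ∧ (∀ x, |G' x - G x| ≤ s / 2) ∧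
      ∀ x, poissonBracket σ F' G' x = 0 := by
  have hF : ContMDiff (𝓡 2) 𝓘(ℝ, ℝ) ∞ fun x => (F x - a) / s :=
    (F.contMDiff.sub contMDiff_const).div_const s
  have hG : ContMDiff (𝓡 2) 𝓘(ℝ, ℝ) ∞ fun x => (G x - b) / s :=
    (G.contMDiff.sub contMDiff_const).div_const s
  have h' : ∀ x, ∀ m n : ℤ, ¬ ((G x - b) / s = m ∧ (F x - a) / s = n) :=
    fun x m n hmn => h x n m hmn.symm
  have hFG := hF.prodMk_space hG
  have hGF := hG.prodMk_space hF
  let F' : C^∞⟮𝓡 2, M; ℝ⟯ := ⟨fun x => a + s * gridRetract ((G x - b) / s) ((F x - a) / s),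
    fun x => contMDiffAt_const.add (contMDiffAt_const.mul
      ((contDiffAt_gridRetract (h' x)).contMDiffAt.comp x (hGF x)))⟩
  let G' : C^∞⟮𝓡 2, M; ℝ⟯ := ⟨fun x => b + s * gridRetract ((F x - a) / s) ((G x - b) / s),
    fun x => contMDiffAt_const.add (contMDiffAt_const.mul
      ((contDiffAt_gridRetract (h x)).contMDiffAt.comp x (hFG x)))⟩
  have hdist : ∀ u v c : ℝ, |c + s * gridRetract u ((v - c) / s) - v| ≤ s / 2 := fun u v c => by
    have h1 : c + s * gridRetract u ((v - c) / s) - v =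
        s * (gridRetract u ((v - c) / s) - (v - c) / s) := by
      field_simp; ring
    rw [h1, abs_mul, abs_of_pos hs]
    nlinarith [abs_gridRetract_sub_le u ((v - c) / s)]
  refine ⟨F', G', fun x => hdist _ _ _, fun x => hdist _ _ _, fun x => ?_⟩
  have hone := latticeRatio_add_swap (h x)
  -- Near x, either G' or F' is constant, so dF' ∧ dG' = 0 at x.
  by_cases hr : 1 / 3 < latticeRatio ((F x - a) / s) ((G x - b) / s)
  · have hd : mvfderiv (𝓡 2) G' x = 0 := by
      refine mvfderiv_eq_zero_of_eventually_const (c := b + s * (⌊(G x - b) / s⌋ + 1 / 2)) ?_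
      filter_upwards [hFG.continuous.continuousAt.eventually
        (gridRetract_eventually_const (h x) hr)] with z hz
      exact congrArg (fun r => b + s * r) hz
    simp [poissonBracket, wedgeForm_apply, hd]
  · have hd : mvfderiv (𝓡 2) F' x = 0 := by
      refine mvfderiv_eq_zero_of_eventually_const (c := a + s * (⌊(F x - a) / s⌋ + 1 / 2)) ?_
      filter_upwards [hGF.continuous.continuousAt.eventually
        (gridRetract_eventually_const (h' x) (by linarith))] with z hz
      exact congrArg (fun r => a + s * r) hz
    simp [poissonBracket, wedgeForm_apply, hd]

theorem corollary1 {M : Type*} [TopologicalSpace M] [ChartedSpace (EuclideanSpace ℝ (Fin 2)) M]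
    [IsManifold (𝓡 2) ∞ M] [T2Space M] [CompactSpace M] (σ : AreaForm M) (F G : C(M, ℝ)) :
    PoissonCommute σ F G ↔
      ∃ Fs Gs : ℕ → C^∞⟮𝓡 2, M; ℝ⟯,
        TendstoUniformly (fun k x => Fs k x) F atTop ∧
        TendstoUniformly (fun k x => Gs k x) G atTop ∧
        ∀ k x, poissonBracket σ (Fs k) (Gs k) x = 0 := by
  constructor
  swap
  · rintro ⟨Fs, Gs, hF, hG, h⟩
    refine ⟨Fs, Gs, hF, hG, ?_⟩
    exact Metric.tendstoUniformly_iff.2 fun δ hδ => Eventually.of_forall fun k x => by simpa [h] using hδ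
  rintro ⟨Fs, Gs, hF, hG, hB⟩
  obtain ⟨C, hC, hvol⟩ := exists_volume_range_le σ
  -- With s = 1 / (n + 1), the error is at most s from the given approximation plus s / 2 from the
  -- retraction.
  have key : ∀ n : ℕ, ∃ F' G' : C^∞⟮𝓡 2, M; ℝ⟯,
      (∀ x, |F' x - F x| ≤ 2 * (1 / ((n : ℝ) + 1))) ∧
      (∀ x, |G' x - G x| ≤ 2 * (1 / ((n : ℝ) + 1))) ∧ ∀ x, poissonBracket σ F' G' x = 0 := by
    intro n
    have hs : (0 : ℝ) < 1 / ((n : ℝ) + 1) := by positivity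
    set s : ℝ := 1 / ((n : ℝ) + 1)
    obtain ⟨ε, hε, hCε⟩ : ∃ ε : ℝ, 0 < ε ∧ C * ENNReal.ofReal ε < ENNReal.ofReal (s ^ 2) := by
      lift C to NNReal using hC
      -- Adding 1 makes the inequality strict and covers C = 0.
      refine ⟨s ^ 2 / (C + 1), by positivity, ?_⟩
      rw [← ENNReal.ofReal_coe_nnreal, ← ENNReal.ofReal_mul C.coe_nonneg]
      refine (ENNReal.ofReal_lt_ofReal_iff (by positivity)).2 ?_
      rw [← mul_div_assoc, div_lt_iff₀ (by positivity)]
      nlinarith [pow_pos hs 2]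
    obtain ⟨k, hkF, hkG, hkB⟩ := ((Metric.tendstoUniformly_iff.1 hF s hs).and
      ((Metric.tendstoUniformly_iff.1 hG s hs).and (Metric.tendstoUniformly_iff.1 hB ε hε))).exists
    obtain ⟨t, ht⟩ := exists_translate_lattice_disjoint hs
      ((hvol (Fs k) (Gs k) ε fun x => by simpa using (hkB x).le).trans_lt hCε)
    obtain ⟨F', G', hF', hG', h0⟩ := exists_commuting_of_avoids_lattice σ (Fs k) (Gs k) hs (t 0) (t 1)
      fun x m n => ht _ (Set.mem_range_self x) m n
    refine ⟨F', G', fun x => ?_, fun x => ?_, h0⟩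
    · have h1 := hkF x
      rw [dist_comm, Real.dist_eq] at h1
      linarith [hF' x, abs_sub_le (F' x) (Fs k x) (F x)]
    · have h1 := hkG x
      rw [dist_comm, Real.dist_eq] at h1
      linarith [hG' x, abs_sub_le (G' x) (Gs k x) (G x)]
  choose Fs' Gs' hF' hG' h0 using key
  have hlim : Tendsto (fun n : ℕ => 2 * (1 / ((n : ℝ) + 1))) atTop (𝓝 0) := by
    simpa using tendsto_one_div_add_atTop_nhds_zero_nat.const_mul (2 : ℝ)
  have hunif : ∀ (H : M → ℝ) (Hs : ℕ → M → ℝ),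
      (∀ n x, |Hs n x - H x| ≤ 2 * (1 / ((n : ℝ) + 1))) → TendstoUniformly Hs H atTop := by
    intro H Hs hH
    rw [Metric.tendstoUniformly_iff]
    intro δ hδ
    filter_upwards [hlim.eventually (gt_mem_nhds hδ)] with n hn x
    rw [dist_comm, Real.dist_eq]
    exact (hH n x).trans_lt hn
  exact ⟨Fs', Gs', hunif _ _ hF', hunif _ _ hG', h0⟩
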